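/- Let $(X,d)$ be a compact metric space with base point $\bullet\in X$, and let $R>0$ be such that $X$ is simply connected up to scale $R$, i.e. for every $x\in X$ and every $0<r<R$ the open ball $\{y\in X : d(x,y)<r\}$ is simply connected (in particular path connected). For $r>0$ let $\mathrm{Rips}(X,r)$ be the (open) Rips complex: the abstract simplicial complex with vertex set $X$ whose simplices are the nonempty finite subsets $\sigma\subseteq X$ with $\operatorname{Diam}(\sigma)<r$; its fundamental group is that of its geometric realization (with the weak topology), based at the vertex $\bullet$. Then 1. $\pi_1(\mathrm{Rips}(X,r),\bullet)\cong\pi_1(X,\bullet)$ for every $r$ with $0<r<R/3$; 2. for all $0<r<r'<R/3$ the natural inclusion $i_{r,r'}\colon \mathrm{Rips}(X,r)\hookrightarrow\mathrm{Rips}(X,r')$ induces an isomorphism $\pi_1(\mathrm{Rips}(X,r),\bullet)\to\pi_1(\mathrm{Rips}(X,r'),\bullet)$. -/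

import Mathlib

noncomputable section

/-- The open Rips complex `Rips(X, r)`: the simplices are the nonempty finite subsets of `X` of
diameter `< r`. (For `r ≤ 0` there are none; for `r > 0` every point of `X` is a vertex.) -/
def ripsComplex (X : Type*) [MetricSpace X] (r : ℝ) : PreAbstractSimplicialComplex X where
  faces := {s | s.Nonempty ∧ Metric.diam (s : Set X) < r}
  isRelLowerSet_faces := fun s hs => ⟨hs.1, fun _ hts ht => ⟨ht,
    (Metric.diam_mono (Finset.coe_subset.mpr hts) s.finite_toSet.isBounded).trans_lt hs.2⟩⟩

namespace PreAbstractSimplicialComplex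

variable {V : Type*}

/-- The points of the geometric realization `|K|`, in barycentric coordinates: finitely supported
nonnegative functions on the vertices, with total mass `1` and whose support is a simplex. -/
@[ext]
structure Realization (K : PreAbstractSimplicialComplex V) where
  /-- The barycentric coordinates. -/
  coord : V →₀ ℝ
  support_mem : coord.support ∈ K
  nonneg : ∀ v, 0 ≤ coord v
  sum_eq_one : (coord.sum fun _ a => a) = 1

/-- The closed simplex of `|K|` spanned by `s`. -/
@[ext]
structure ClosedSimplex (K : PreAbstractSimplicialComplex V) (s : Finset V) where
  /-- The underlying point of `|K|`. -/
  point : K.Realization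
  support_subset : point.coord.support ⊆ s

/-- A closed simplex carries its Euclidean topology, that of its barycentric coordinates. -/
instance (K : PreAbstractSimplicialComplex V) (s : Finset V) :
    TopologicalSpace (K.ClosedSimplex s) :=
  TopologicalSpace.induced (fun x => (fun v => x.point.coord v : V → ℝ)) inferInstance

/-- The weak (coherent) topology on `|K|`: the finest topology for which the inclusion of every
closed simplex is continuous. -/
instance (K : PreAbstractSimplicialComplex V) : TopologicalSpace K.Realization :=
  ⨆ s : {s : Finset V // s ∈ K},
    TopologicalSpace.coinduced (ClosedSimplex.point (K := K) (s := s.1)) inferInstance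

/-- A vertex of `K` as a point of `|K|`. -/
def vertex (K : PreAbstractSimplicialComplex V) (v : V) (hv : {v} ∈ K) : K.Realization where
  coord := Finsupp.single v 1
  support_mem := by rwa [Finsupp.support_single v one_ne_zero]
  nonneg w := by classical rw [Finsupp.single_apply]; split_ifs <;> norm_num
  sum_eq_one := by simp

/-- The inclusion `|K| ↪ |L|` of a subcomplex. -/
def inclusion {K L : PreAbstractSimplicialComplex V} (h : K ≤ L) :
    C(K.Realization, L.Realization) where
  toFun x := ⟨x.coord, h x.support_mem, x.nonneg, x.sum_eq_one⟩
  continuous_toFun := by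
    refine continuous_iSup_dom.2 fun s => continuous_coinduced_dom.2 ?_
    have h1 : Continuous (ClosedSimplex.point (K := L) (s := s.1)) :=
      continuous_iff_coinduced_le.2 (le_iSup (fun t : {t : Finset V // t ∈ L} =>
        TopologicalSpace.coinduced (ClosedSimplex.point (K := L) (s := t.1)) inferInstance)
        ⟨s.1, h s.2⟩)
    have h2 : Continuous (fun x : K.ClosedSimplex s.1 =>
        (⟨⟨x.point.coord, h x.point.support_mem, x.point.nonneg, x.point.sum_eq_one⟩,
          x.support_subset⟩ : L.ClosedSimplex s.1)) :=
      continuous_induced_rng.2 continuous_induced_dom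
    exact h1.comp h2

end PreAbstractSimplicialComplex

/-- The base point: the vertex `x` of `|Rips(X, r)|`. -/
def ripsVertex {X : Type*} [MetricSpace X] {r : ℝ} (hr : 0 < r) (x : X) :
    (ripsComplex X r).Realization :=
  (ripsComplex X r).vertex x ⟨Finset.singleton_nonempty x, by simpa using hr⟩

/-- The natural inclusion `i_{r,r'} : |Rips(X, r)| ↪ |Rips(X, r')|` for `r ≤ r'`. -/
def ripsInclusion (X : Type*) [MetricSpace X] {r r' : ℝ} (h : r ≤ r') :
    C((ripsComplex X r).Realization, (ripsComplex X r').Realization) :=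
  PreAbstractSimplicialComplex.inclusion fun _ hs => ⟨hs.1, hs.2.trans_le h⟩

theorem ripsInclusion_vertex {X : Type*} [MetricSpace X] {r r' : ℝ} (hr : 0 < r) (h : r ≤ r')
    (x : X) : ripsInclusion X h (ripsVertex hr x) = ripsVertex (hr.trans_le h) x := rfl

/-- `X` is simply connected up to scale `R`: every open ball of radius `0 < r < R` is simply
connected. -/
def SimplyConnectedUpToScale (X : Type*) [MetricSpace X] (R : ℝ) : Prop :=
  ∀ (x : X) (r : ℝ), 0 < r → r < R → IsSimplyConnected (Metric.ball x r)

end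

/-!
The fundamental groupoids of `X` and of `|Rips(X, r)|` are equivalent. A functor out of a
fundamental groupoid can be glued from local data: it suffices to transport between points lying in
a common member of an open cover, compatibly on each member, since the transport then defines
covering spaces whose monodromy is the functor. From `X`, cover by balls of radius `r / 2` and send
a pair of nearby points to the edge joining them. From `|Rips(X, r)|`, cover by the open stars of
the vertices: carrier vertices of two points of the star of `v` lie in the ball of radius `r` about
`v`, and all paths joining them inside some `r`-ball are homotopic, because two such balls lie in a
common simply connected ball of radius `2 * r`. The two functors are mutually inverse and compatible
with enlarging `r`, since naturality can also be checked locally.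
-/

open CategoryTheory Filter Set Topology

section PathClass

variable {Y : Type*} [TopologicalSpace Y]

/-- The homotopy class of a path, as a morphism of the fundamental groupoid. -/
def pathClass {x y : Y} (p : Path x y) : FundamentalGroupoid.mk x ⟶ FundamentalGroupoid.mk y :=
  Path.Homotopic.Quotient.mk p

theorem pathClass_eq_iff {x y : Y} {p q : Path x y} :
    pathClass p = pathClass q ↔ p.Homotopic q :=
  FundamentalGroupoid.fromPath_eq_iff_homotopic p q

theorem pathClass_trans {x y z : Y} (p : Path x y) (q : Path y z) :
    pathClass (p.trans q) = pathClass p ≫ pathClass q := rfl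

theorem pathClass_surjective {x y : Y} (f : FundamentalGroupoid.mk x ⟶ FundamentalGroupoid.mk y) :
    ∃ p, pathClass p = f :=
  Quotient.exists_rep f

theorem pathClass_mem_of_local {ι : Type*} {U : ι → Set Y} (hU : ∀ i, IsOpen (U i))
    {P : ∀ {x y : Y}, (FundamentalGroupoid.mk x ⟶ FundamentalGroupoid.mk y) → Prop}
    (comp : ∀ {x y z : Y} (f : FundamentalGroupoid.mk x ⟶ FundamentalGroupoid.mk y)
      (g : FundamentalGroupoid.mk y ⟶ FundamentalGroupoid.mk z), P f → P g → P (f ≫ g))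
    {x y : Y} (p : Path x y) (hp : ∀ t, ∃ i, p t ∈ U i)
    (local_mem : ∀ i {a b : Y} (q : Path a b), range q ⊆ range p → range q ⊆ U i →
      P (pathClass q)) :
    P (pathClass p) := by
  obtain ⟨t, ht₀, hmono, ⟨m, hm⟩, ht⟩ := exists_monotone_Icc_subset_open_cover_unitInterval
    (c := fun i => p ⁻¹' U i) (fun i => (hU i).preimage p.continuous)
    (fun s _ => mem_iUnion.2 (hp s))
  have piece (n : ℕ) : P (pathClass (p.subpath (t n) (t (n + 1)))) := by
    obtain ⟨i, hi⟩ := ht n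
    have hrange := Path.range_subpath_of_le p _ _ (hmono n.le_succ)
    exact local_mem i _ (hrange ▸ image_subset_range _ _) (hrange ▸ image_subset_iff.2 hi)
  have initial (n : ℕ) : P (pathClass (p.subpath (t 0) (t (n + 1)))) := by
    induction n with
    | zero => exact piece 0
    | succ n ih =>
      rw [← pathClass_eq_iff.2 ⟨Path.Homotopy.subpathTransSubpath p _ (t (n + 1)) _⟩]
      exact comp _ _ ih (piece (n + 1))
  have whole := initial m
  rw [ht₀, hm (m + 1) m.le_succ, Path.subpath_zero_one] at whole
  obtain ⟨p, rfl, rfl⟩ := p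
  exact whole

theorem naturality_of_local {ι : Type*} {U : ι → Set Y} (hU : ∀ i, IsOpen (U i)) {S : Set Y}
    (hS : S ⊆ ⋃ i, U i) {C : Type*} [Category C] {F G : FundamentalGroupoid Y ⥤ C}
    (τ : ∀ y ∈ S, F.obj ⟨y⟩ ⟶ G.obj ⟨y⟩)
    (h : ∀ i {x y : Y} (p : Path x y), range p ⊆ U i → ∀ (hx : x ∈ S) (hy : y ∈ S),
      F.map (pathClass p) ≫ τ y hy = τ x hx ≫ G.map (pathClass p))
    {x y : Y} (p : Path x y) (hp : range p ⊆ S) (hx : x ∈ S) (hy : y ∈ S) :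
    F.map (pathClass p) ≫ τ y hy = τ x hx ≫ G.map (pathClass p) := by
  obtain ⟨_, _, hnat⟩ := pathClass_mem_of_local hU
    (P := fun {x y} f => ∃ (hx : x ∈ S) (hy : y ∈ S), F.map f ≫ τ y hy = τ x hx ≫ G.map f)
    (fun f g ⟨hx, _, hf⟩ ⟨_, hz, hg⟩ => ⟨hx, hz, by
      rw [F.map_comp, G.map_comp, Category.assoc, hg, reassoc_of% hf]⟩)
    p (fun t => mem_iUnion.1 (hS (hp ⟨t, rfl⟩)))
    (fun i a b q hqp hqU =>
      have ha : a ∈ S := hp (hqp ⟨0, q.source⟩)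
      have hb : b ∈ S := hp (hqp ⟨1, q.target⟩)
      ⟨ha, hb, h i q hqU ha hb⟩)
  exact hnat

/-- A natural isomorphism of functors on the fundamental groupoid, whose naturality is checked on
paths inside the members of an open cover. -/
noncomputable def natIsoOfLocal {ι : Type*} {U : ι → Set Y} (hU : ∀ i, IsOpen (U i))
    (hcover : ∀ y, ∃ i, y ∈ U i) {C : Type*} [Groupoid C] {F G : FundamentalGroupoid Y ⥤ C}
    (τ : ∀ y : Y, F.obj ⟨y⟩ ⟶ G.obj ⟨y⟩)
    (h : ∀ i {x y : Y} (p : Path x y), range p ⊆ U i →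
      F.map (pathClass p) ≫ τ y = τ x ≫ G.map (pathClass p)) : F ≅ G :=
  NatIso.ofComponents (fun y => (Groupoid.isoEquivHom _ _).symm (τ y.as)) fun {x y} f => by
    obtain ⟨p, rfl⟩ := pathClass_surjective f
    exact naturality_of_local hU (fun y _ => mem_iUnion.2 (hcover y)) (fun y _ => τ y)
      (fun i _ _ p hp _ _ => h i p hp) p (subset_univ _) trivial trivial

end PathClass

section Glue

variable {Y ι : Type*} [TopologicalSpace Y] {C : Type*} [Category C] {U : ι → Set Y}

theorem monodromy_naturality {E E' : Type*} [TopologicalSpace E] [TopologicalSpace E']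
    {p : E → Y} {p' : E' → Y} (cov : IsCoveringMap p) (cov' : IsCoveringMap p') {g : E → E'}
    (hg : Continuous g) (hpg : ∀ e, p' (g e) = p e) {x y : Y} (γ : Path.Homotopic.Quotient x y)
    (e : p ⁻¹' {x}) :
    (cov'.monodromy γ ⟨g e, (hpg e).trans e.2⟩ : E') = g (cov.monodromy γ e) := by
  obtain ⟨γ⟩ := γ
  have hγ : γ 0 = p e := γ.source.trans e.2.symm
  refine congr($((cov'.eq_liftPath_iff' (Γ := .comp ⟨g, hg⟩ (cov.liftPath γ e hγ))
    (hγ.trans (hpg e).symm)).mpr ⟨?_, congrArg g (cov.liftPath_zero ..)⟩) 1).symm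
  exact funext fun t => (hpg _).trans congr($(cov.liftPath_lifts γ e hγ) t)

/-- A family of objects over the points of `Y` with a transport between any two points lying in a
common member of `U`. The transport does not depend on that member, and is functorial within each
member. -/
structure LocalTransport (U : ι → Set Y) (C : Type*) [Category C] where
  /-- The object over a point. -/
  obj : Y → C
  /-- The transport between two points of a common member of the cover. -/
  hom {x y : Y} (h : ∃ i, x ∈ U i ∧ y ∈ U i) : obj x ⟶ obj y
  hom_self {x : Y} (h : ∃ i, x ∈ U i ∧ x ∈ U i) : hom h = 𝟙 (obj x)
  hom_comp {i : ι} {x y z : Y} (hx : x ∈ U i) (hy : y ∈ U i) (hz : z ∈ U i) :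
    hom ⟨i, hx, hy⟩ ≫ hom ⟨i, hy, hz⟩ = hom ⟨i, hx, hz⟩

namespace LocalTransport

variable (T : LocalTransport U C) (c : C)

/-- The covering space of `Y` whose fibre over `y` consists of the morphisms from `c` to the object
over `y`, a morphism being continued to nearby points by composition with the local transport. -/
structure Cover where
  /-- The projection to `Y`. -/
  proj : Y
  /-- The point of the fibre. -/
  arrow : c ⟶ T.obj proj

variable {T c}

instance : TopologicalSpace (T.Cover c) where
  IsOpen s := ∀ e ∈ s, ∀ᶠ y in 𝓝 e.proj, ∀ h, ⟨y, e.arrow ≫ T.hom h⟩ ∈ s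
  isOpen_univ := fun _ _ => Eventually.of_forall fun _ _ => mem_univ _
  isOpen_inter := fun s t hs ht e he => by
    filter_upwards [hs e he.1, ht e he.2] with y h₁ h₂ h using ⟨h₁ h, h₂ h⟩
  isOpen_sUnion := fun S hS e ⟨s, hs, he⟩ => by
    filter_upwards [hS s hs e he] with y hy h using ⟨s, hs, hy h⟩

theorem Cover.isOpen_iff {s : Set (T.Cover c)} :
    IsOpen s ↔ ∀ e ∈ s, ∀ᶠ y in 𝓝 e.proj, ∀ h, ⟨y, e.arrow ≫ T.hom h⟩ ∈ s :=
  Iff.rfl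

theorem Cover.continuous_proj : Continuous (Cover.proj : T.Cover c → Y) :=
  continuous_def.2 fun _ hV _ he => Eventually.mono (hV.mem_nhds he) fun _ hy _ => hy

theorem Cover.continuous_precomp {d : C} (φ : d ⟶ c) :
    Continuous fun e : T.Cover c => (⟨e.proj, φ ≫ e.arrow⟩ : T.Cover d) :=
  ⟨fun s hs e he => (isOpen_iff.1 hs _ he).mono fun y hy h => by
    simpa only [mem_preimage, Category.assoc] using hy h⟩

/-- The local section through `⟨x, m⟩` over a member of the cover. -/
def Cover.localSection {i : ι} {x : Y} (hx : x ∈ U i) (m : c ⟶ T.obj x) : C(U i, T.Cover c) where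
  toFun y := ⟨y, m ≫ T.hom ⟨i, hx, y.2⟩⟩
  continuous_toFun := by
    refine ⟨fun s hs => isOpen_iff_mem_nhds.2 fun y hy => ?_⟩
    have near := continuous_subtype_val.continuousAt.eventually (isOpen_iff.1 hs _ hy)
    filter_upwards [near] with z hz
    simpa only [mem_preimage, Category.assoc, T.hom_comp hx y.2 z.2] using hz ⟨i, y.2, z.2⟩

theorem Cover.isLocallyConstant_arrow {i : ι} (hU : IsOpen (U i)) {x : Y} (hx : x ∈ U i) :
    IsLocallyConstant fun e : (Cover.proj : T.Cover c → Y) ⁻¹' U i =>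
      e.1.arrow ≫ T.hom ⟨i, e.2, hx⟩ := by
  intro s
  rw [(hU.preimage continuous_proj).isOpenEmbedding_subtypeVal.isOpen_iff_image_isOpen,
    isOpen_iff]
  rintro _ ⟨⟨e, he⟩, hs, rfl⟩
  filter_upwards [hU.mem_nhds he] with y hy h
  refine ⟨⟨⟨y, e.arrow ≫ T.hom h⟩, hy⟩, ?_, rfl⟩
  simpa only [mem_preimage, Category.assoc, T.hom_comp he hy hx] using hs

theorem Cover.isCoveringMap (hU : ∀ i, IsOpen (U i)) (hcover : ∀ y, ∃ i, y ∈ U i) :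
    IsCoveringMap (Cover.proj : T.Cover c → Y) := fun x => by
  obtain ⟨i, hx⟩ := hcover x
  let _ : TopologicalSpace (c ⟶ T.obj x) := ⊥
  have : DiscreteTopology (c ⟶ T.obj x) := ⟨rfl⟩
  refine IsEvenlyCovered.to_isEvenlyCovered_preimage (I := c ⟶ T.obj x)
    ⟨inferInstance, U i, hx, hU i, (hU i).preimage continuous_proj, ?_⟩
  exact ⟨{
    toFun := fun e => (⟨e.1.proj, e.2⟩, e.1.arrow ≫ T.hom ⟨i, e.2, hx⟩)
    invFun := fun a => ⟨⟨a.1, a.2 ≫ T.hom ⟨i, hx, a.1.2⟩⟩, a.1.2⟩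
    left_inv := fun ⟨⟨y, m⟩, hy⟩ => by
      simp only [Category.assoc, T.hom_comp hy hx hy, T.hom_self, Category.comp_id]
    right_inv := fun ⟨y, m⟩ => by
      simp only [Category.assoc, T.hom_comp hx y.2 hx, T.hom_self, Category.comp_id]
    continuous_toFun := ((continuous_proj.comp continuous_subtype_val).subtype_mk _).prodMk
      (isLocallyConstant_arrow (hU i) hx).continuous
    continuous_invFun := continuous_prod_of_discrete_right.2 fun m =>
      (localSection hx m).continuous.subtype_mk _ }, fun _ => rfl⟩

variable (T c) in
/-- The fibre of `LocalTransport.Cover` over a point. -/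
@[simps symm_apply_coe]
def Cover.fiberEquiv (x : Y) : (Cover.proj : T.Cover c → Y) ⁻¹' {x} ≃ (c ⟶ T.obj x) where
  toFun e := e.1.arrow ≫ eqToHom (congrArg T.obj e.2)
  invFun m := ⟨⟨x, m⟩, rfl⟩
  left_inv := by rintro ⟨⟨y, m⟩, rfl⟩; simp
  right_inv m := by simp

section Functor

variable (hU : ∀ i, IsOpen (U i)) (hcover : ∀ y, ∃ i, y ∈ U i) {x y z : Y}

variable (T) in
/-- Transport along a homotopy class of paths, by the monodromy of `LocalTransport.Cover`. -/
noncomputable def transport (γ : Path.Homotopic.Quotient x y) (m : c ⟶ T.obj x) : c ⟶ T.obj y :=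
  Cover.fiberEquiv T c y
    ((Cover.isCoveringMap hU hcover).monodromy γ ((Cover.fiberEquiv T c x).symm m))

theorem transport_eq_iff {γ : Path.Homotopic.Quotient x y} {m : c ⟶ T.obj x} {n : c ⟶ T.obj y} :
    T.transport hU hcover γ m = n ↔
      ((Cover.isCoveringMap hU hcover).monodromy γ ((Cover.fiberEquiv T c x).symm m)).1 =
        ⟨y, n⟩ := by
  rw [transport, ← Equiv.eq_symm_apply, Subtype.ext_iff, Cover.fiberEquiv_symm_apply_coe]

theorem transport_precomp {d : C} (γ : Path.Homotopic.Quotient x y) (φ : d ⟶ c)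
    (m : c ⟶ T.obj x) :
    T.transport hU hcover γ (φ ≫ m) = φ ≫ T.transport hU hcover γ m := by
  rw [transport_eq_iff]
  refine (monodromy_naturality (Cover.isCoveringMap hU hcover)
    (Cover.isCoveringMap hU hcover) (Cover.continuous_precomp φ)
    (fun _ => rfl) γ ((Cover.fiberEquiv T c x).symm m)).trans ?_
  rw [(transport_eq_iff hU hcover).1 rfl]

theorem transport_mk {i : ι} (p : Path x y) (hp : ∀ t, p t ∈ U i) (hx : x ∈ U i) (hy : y ∈ U i)
    (m : c ⟶ T.obj x) : T.transport hU hcover (.mk p) m = m ≫ T.hom ⟨i, hx, hy⟩ := by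
  have cov := Cover.isCoveringMap (T := T) (c := c) hU hcover
  let lift := (Cover.localSection hx m).comp ⟨fun t => ⟨p t, hp t⟩, p.continuous.subtype_mk hp⟩
  have lift_zero : lift 0 = ⟨x, m⟩ :=
    (congrArg (Cover.localSection hx m) (Subtype.ext p.source : _ = ⟨x, hx⟩)).trans
      (by simp only [Cover.localSection, ContinuousMap.coe_mk, T.hom_self, Category.comp_id])
  have lift_one : lift 1 = ⟨y, m ≫ T.hom ⟨i, hx, hy⟩⟩ :=
    congrArg (Cover.localSection hx m) (Subtype.ext p.target : _ = ⟨y, hy⟩)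
  rw [transport_eq_iff, ← lift_one]
  exact congr($((cov.eq_liftPath_iff' (Γ := lift) p.source).mpr ⟨rfl, lift_zero⟩) 1).symm

variable (T) in
/-- The functor on the fundamental groupoid glued from a local transport. -/
@[simps]
noncomputable def glue : FundamentalGroupoid Y ⥤ C where
  obj x := T.obj x.as
  map γ := T.transport hU hcover γ (𝟙 _)
  map_id x := by
    rw [transport_eq_iff]
    exact congrArg Subtype.val (congrFun (Cover.isCoveringMap hU hcover).monodromy_refl _)
  map_comp {x y z} γ γ' := by
    conv_rhs => rw [← transport_precomp, Category.comp_id]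
    rw [transport, FundamentalGroupoid.comp_eq, IsCoveringMap.monodromy_trans_apply, transport,
      transport, Equiv.symm_apply_apply]

variable (T) in
theorem glue_map_pathClass {i : ι} {p : Path x y} (hp : range p ⊆ U i) (hx : x ∈ U i)
    (hy : y ∈ U i) : (T.glue hU hcover).map (pathClass p) = T.hom ⟨i, hx, hy⟩ := by
  refine (glue_map ..).trans ?_
  exact (transport_mk hU hcover p (fun t => hp ⟨t, rfl⟩) hx hy (𝟙 _)).trans (Category.id_comp _)

end Functor

end LocalTransport

end Glue

section SimplyConnected

variable {Y : Type*} [TopologicalSpace Y]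

theorem pathClass_eq_of_isSimplyConnected {S : Set Y} (hS : IsSimplyConnected S) {x y : Y}
    {p q : Path x y} (hp : range p ⊆ S) (hq : range q ⊆ S) : pathClass p = pathClass q := by
  have := hS.simplyConnectedSpace
  have hx : x ∈ S := hp ⟨0, p.source⟩
  have hy : y ∈ S := hp ⟨1, p.target⟩
  let restrict (r : Path x y) (hr : range r ⊆ S) : Path (⟨x, hx⟩ : S) ⟨y, hy⟩ :=
    { toFun := fun t => ⟨r t, hr ⟨t, rfl⟩⟩
      source' := Subtype.ext r.source
      target' := Subtype.ext r.target }
  exact pathClass_eq_iff.2 ((SimplyConnectedSpace.paths_homotopic (restrict p hp)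
    (restrict q hq)).map ⟨_, continuous_subtype_val⟩)

end SimplyConnected

section Realization

open PreAbstractSimplicialComplex

variable {V Z : Type*} [TopologicalSpace Z] {K : PreAbstractSimplicialComplex V}
  {s : Finset V} {v : V} {x y z : K.Realization}

theorem isOpen_realization_iff {W : Set K.Realization} :
    IsOpen W ↔ ∀ s ∈ K, IsOpen ((ClosedSimplex.point : K.ClosedSimplex s → _) ⁻¹' W) := by
  simp only [isOpen_iSup_iff, isOpen_coinduced, Subtype.forall]

theorem continuous_realization_iff {f : K.Realization → Z} :
    Continuous f ↔ ∀ s ∈ K, Continuous fun a : K.ClosedSimplex s => f a.point := by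
  simp only [continuous_def, isOpen_realization_iff]
  exact ⟨fun h s hs O hO => h O hO s hs, fun h O hO s hs => h s hs O hO⟩

theorem continuous_of_isOpen_realization {W : Set K.Realization} (hW : IsOpen W) {f : W → Z}
    (hf : ∀ s ∈ K, Continuous fun a : {a : K.ClosedSimplex s // a.point ∈ W} =>
      f ⟨a.1.point, a.2⟩) : Continuous f := by
  refine ⟨fun O hO => ?_⟩
  rw [hW.isOpenEmbedding_subtypeVal.isOpen_iff_image_isOpen, isOpen_realization_iff]
  intro s hs
  have hWs : IsOpen {a : K.ClosedSimplex s | a.point ∈ W} := isOpen_realization_iff.1 hW s hs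
  have himage := hWs.isOpenEmbedding_subtypeVal.isOpenMap _ (hO.preimage (hf s hs))
  convert! himage using 1
  ext a
  simp

theorem continuous_closedSimplex_coord (v : V) :
    Continuous fun a : K.ClosedSimplex s => a.point.coord v :=
  continuous_pi_iff.1 continuous_induced_dom v

theorem continuous_coord (v : V) : Continuous fun x : K.Realization => x.coord v :=
  continuous_realization_iff.2 fun _ _ => continuous_closedSimplex_coord v

theorem continuous_of_support_subset (hs : s ∈ K) {g : Z → K.Realization}
    (hsupp : ∀ a, (g a).coord.support ⊆ s) (hcoord : ∀ v, Continuous fun a => (g a).coord v) :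
    Continuous g :=
  (continuous_realization_iff.1 continuous_id s hs).comp
    (g := ClosedSimplex.point) (f := fun a => (⟨g a, hsupp a⟩ : K.ClosedSimplex s))
    (continuous_induced_rng.2 (continuous_pi hcoord))

theorem support_nonempty (x : K.Realization) : x.coord.support.Nonempty :=
  (K.isRelLowerSet_faces x.support_mem).1

/-- A chosen vertex of the smallest closed simplex containing a point. -/
noncomputable def carrierVertex (x : K.Realization) : V := (support_nonempty x).choose

theorem carrierVertex_mem_support (x : K.Realization) : carrierVertex x ∈ x.coord.support :=
  (support_nonempty x).choose_spec

/-- Two points of the realization lie in a common closed simplex. -/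
def SameFace (x y : K.Realization) : Prop :=
  ∃ s ∈ K, x.coord.support ⊆ s ∧ y.coord.support ⊆ s

section Segment

variable {f g : V →₀ ℝ}

theorem support_lineMap_subset (hf : f.support ⊆ s) (hg : g.support ⊆ s) (t : ℝ) :
    (AffineMap.lineMap f g t : V →₀ ℝ).support ⊆ s := by
  classical
  rw [AffineMap.lineMap_apply_module]
  exact Finsupp.support_add.trans
    (Finset.union_subset (Finsupp.support_smul.trans hf) (Finsupp.support_smul.trans hg))

theorem finsupp_lineMap_apply (f g : V →₀ ℝ) (t : ℝ) (v : V) :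
    (AffineMap.lineMap f g t : V →₀ ℝ) v = AffineMap.lineMap (f v) (g v) t :=
  (Finsupp.lapply (R := ℝ) v).toAffineMap.apply_lineMap f g t

theorem sum_lineMap_eq_one (hf : (f.sum fun _ a => a) = 1) (hg : (g.sum fun _ a => a) = 1) (t : ℝ) :
    ((AffineMap.lineMap f g t : V →₀ ℝ).sum fun _ a => a) = 1 := by
  let mass : (V →₀ ℝ) →ₗ[ℝ] ℝ := Finsupp.lsum ℝ fun _ => LinearMap.id
  have hmass : mass (AffineMap.lineMap f g t) = AffineMap.lineMap (mass f) (mass g) t :=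
    mass.toAffineMap.apply_lineMap f g t
  have hf' : mass f = 1 := hf
  have hg' : mass g = 1 := hg
  rwa [hf', hg', AffineMap.lineMap_same_apply] at hmass

theorem support_nonempty_of_sum_eq_one (hf : (f.sum fun _ a => a) = 1) : f.support.Nonempty := by
  rw [Finsupp.support_nonempty_iff]
  rintro rfl
  simp at hf

/-- The point at time `t` of the straight segment from `x` to `y` in a closed simplex. -/
noncomputable def segmentPoint (h : SameFace x y) (t : unitInterval) : K.Realization where
  coord := AffineMap.lineMap x.coord y.coord (t : ℝ)
  support_mem := by
    obtain ⟨s, hs, hx, hy⟩ := h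
    exact (K.isRelLowerSet_faces hs).2 (support_lineMap_subset hx hy t)
      (support_nonempty_of_sum_eq_one (sum_lineMap_eq_one x.sum_eq_one y.sum_eq_one t))
  nonneg v := by
    rw [finsupp_lineMap_apply]
    exact (convex_Ici (0 : ℝ)).lineMap_mem (x.nonneg v) (y.nonneg v) t.2
  sum_eq_one := sum_lineMap_eq_one x.sum_eq_one y.sum_eq_one t

theorem support_segmentPoint_subset (h : SameFace x y) (hx : x.coord.support ⊆ s)
    (hy : y.coord.support ⊆ s) (t : unitInterval) : (segmentPoint h t).coord.support ⊆ s :=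
  support_lineMap_subset hx hy t

theorem coord_segmentPoint (h : SameFace x y) (t : unitInterval) (v : V) :
    (segmentPoint h t).coord v = AffineMap.lineMap (x.coord v) (y.coord v) (t : ℝ) :=
  finsupp_lineMap_apply _ _ _ _

theorem segmentPoint_zero (h : SameFace x y) : segmentPoint h 0 = x :=
  Realization.ext (AffineMap.lineMap_apply_zero _ _)

theorem segmentPoint_one (h : SameFace x y) : segmentPoint h 1 = y :=
  Realization.ext (AffineMap.lineMap_apply_one _ _)

theorem continuous_segmentPoint (hs : s ∈ K) {a b : Z → K.Realization} {t : Z → unitInterval}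
    (hab : ∀ w, SameFace (a w) (b w)) (ha : ∀ w, (a w).coord.support ⊆ s)
    (hb : ∀ w, (b w).coord.support ⊆ s) (ha' : ∀ v, Continuous fun w => (a w).coord v)
    (hb' : ∀ v, Continuous fun w => (b w).coord v) (ht : Continuous t) :
    Continuous fun w => segmentPoint (hab w) (t w) := by
  refine continuous_of_support_subset hs
    (fun w => support_segmentPoint_subset _ (ha w) (hb w) _) fun v => ?_
  simp only [coord_segmentPoint]
  exact (ha' v).lineMap (hb' v) (continuous_subtype_val.comp ht)

/-- The straight segment between two points of a closed simplex. -/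
noncomputable def segmentPath (h : SameFace x y) : Path x y where
  toFun := segmentPoint h
  continuous_toFun := by
    obtain ⟨s, hs, hx, hy⟩ := id h
    exact continuous_segmentPoint hs (fun _ => h) (fun _ => hx) (fun _ => hy)
      (fun _ => continuous_const) (fun _ => continuous_const) continuous_id
  source' := segmentPoint_zero h
  target' := segmentPoint_one h

/-- The class of the straight segment between two points of a closed simplex. -/
noncomputable def segmentClass (h : SameFace x y) :
    FundamentalGroupoid.mk x ⟶ FundamentalGroupoid.mk y :=
  pathClass (segmentPath h)

theorem homotopic_of_sameFace {p q : Path x y} (hpq : ∀ t, SameFace (p t) (q t))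
    (hcont : Continuous fun a : unitInterval × unitInterval => segmentPoint (hpq a.2) a.1) :
    p.Homotopic q := by
  refine ⟨⟨⟨⟨_, hcont⟩, fun t => segmentPoint_zero (hpq t), fun t => segmentPoint_one (hpq t)⟩,
    fun u t ht => ?_⟩⟩
  have heq : p t = q t := by
    rcases ht with rfl | rfl
    · rw [p.source, q.source]
    · rw [p.target, q.target]
  exact Realization.ext (by simp [segmentPoint, heq])

theorem pathClass_eq_of_support_subset (hs : s ∈ K) {p q : Path x y}
    (hp : ∀ t, (p t).coord.support ⊆ s) (hq : ∀ t, (q t).coord.support ⊆ s) :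
    pathClass p = pathClass q := by
  have hpq (t) : SameFace (p t) (q t) := ⟨s, hs, hp t, hq t⟩
  refine pathClass_eq_iff.2 (homotopic_of_sameFace hpq ?_)
  refine continuous_segmentPoint hs (a := fun a : unitInterval × unitInterval => p a.2)
    (b := fun a => q a.2) (t := Prod.fst) (fun a => hpq a.2) (fun a => hp a.2) (fun a => hq a.2)
    ?_ ?_ continuous_fst
  · exact fun v => (continuous_coord v).comp (p.continuous.comp continuous_snd)
  · exact fun v => (continuous_coord v).comp (q.continuous.comp continuous_snd)

theorem pathClass_eq_segmentClass (hs : s ∈ K) {p : Path x y}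
    (hp : ∀ t, (p t).coord.support ⊆ s) (h : SameFace x y) :
    pathClass p = segmentClass h :=
  pathClass_eq_of_support_subset hs hp (support_segmentPoint_subset h
    (p.source ▸ hp 0) (p.target ▸ hp 1))

theorem segmentClass_self (h : SameFace x x) : segmentClass h = 𝟙 _ :=
  (pathClass_eq_segmentClass x.support_mem (p := Path.refl x) (fun _ => subset_rfl) h).symm

theorem segmentClass_comp (hs : s ∈ K) (hx : x.coord.support ⊆ s) (hy : y.coord.support ⊆ s)
    (hz : z.coord.support ⊆ s) :
    segmentClass ⟨s, hs, hx, hy⟩ ≫ segmentClass ⟨s, hs, hy, hz⟩ = segmentClass ⟨s, hs, hx, hz⟩ := by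
  refine pathClass_eq_segmentClass hs (fun t => ?_) _
    (p := (segmentPath ⟨s, hs, hx, hy⟩).trans (segmentPath ⟨s, hs, hy, hz⟩))
  rw [Path.trans_apply]
  split_ifs
  · exact support_segmentPoint_subset ⟨s, hs, hx, hy⟩ hx hy _
  · exact support_segmentPoint_subset ⟨s, hs, hy, hz⟩ hy hz _

theorem SameFace.mono {L : PreAbstractSimplicialComplex V} (hKL : K ≤ L) (h : SameFace x y) :
    SameFace (inclusion hKL x) (inclusion hKL y) :=
  h.imp fun _ hs => ⟨hKL hs.1, hs.2⟩

theorem map_inclusion_segmentClass {L : PreAbstractSimplicialComplex V} (hKL : K ≤ L)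
    (h : SameFace x y) : (FundamentalGroupoid.map (inclusion hKL)).map (segmentClass h) =
      segmentClass (h.mono hKL) := rfl

end Segment

section OpenStar

variable (K v) in
/-- The open star of a vertex: the points whose barycentric coordinate at `v` does not vanish. -/
def openStar : Set K.Realization := {x | x.coord v ≠ 0}

theorem isOpen_openStar : IsOpen (openStar K v) :=
  isOpen_ne.preimage (continuous_coord v)

theorem mem_openStar_iff : x ∈ openStar K v ↔ v ∈ x.coord.support :=
  Finsupp.mem_support_iff.symm

theorem mem_openStar_carrierVertex (x : K.Realization) : x ∈ openStar K (carrierVertex x) :=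
  mem_openStar_iff.2 (carrierVertex_mem_support x)

theorem sameFace_vertex (hv : {v} ∈ K) (hx : x ∈ openStar K v) : SameFace x (K.vertex v hv) :=
  ⟨x.coord.support, x.support_mem, subset_rfl,
    Finsupp.support_single_subset.trans (by simpa using mem_openStar_iff.1 hx)⟩

theorem segmentPoint_mem_openStar (hx : x ∈ openStar K v) (hy : y ∈ openStar K v)
    (h : SameFace x y) (t : unitInterval) : segmentPoint h t ∈ openStar K v := by
  have pos {w : K.Realization} (hw : w ∈ openStar K v) : w.coord v ∈ Ioi 0 :=
    (w.nonneg v).lt_of_ne' hw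
  rw [openStar, mem_ofPred_eq, coord_segmentPoint]
  exact ((convex_Ioi (0 : ℝ)).lineMap_mem (pos hx) (pos hy) t.2).ne'

theorem range_segmentPath_subset_openStar (hx : x ∈ openStar K v) (hy : y ∈ openStar K v)
    (h : SameFace x y) : range (segmentPath h) ⊆ openStar K v :=
  range_subset_iff.2 (segmentPoint_mem_openStar hx hy h)

theorem segmentPoint_mem_openStar_of_mem_Ioo (h : SameFace x y) {t : unitInterval}
    (ht : t ∈ Ioo 0 1) (hv : x ∈ openStar K v ∨ y ∈ openStar K v) :
    segmentPoint h t ∈ openStar K v := by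
  have ht₀ : (0 : ℝ) < t := ht.1
  have ht₁ : 0 < 1 - (t : ℝ) := sub_pos.2 ht.2
  have hx := x.nonneg v
  have hy := y.nonneg v
  rw [openStar, mem_ofPred_eq, coord_segmentPoint, AffineMap.lineMap_apply_ring]
  rcases hv with hv | hv
  · have := hx.lt_of_ne' hv
    positivity
  · have := hy.lt_of_ne' hv
    positivity

theorem vertex_mem_openStar (hv : {v} ∈ K) : K.vertex v hv ∈ openStar K v := by
  simp [openStar, vertex]

theorem continuous_segmentPoint_vertex_of_mem (hv : {v} ∈ K) (hs : s ∈ K) :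
    Continuous fun a : {a : K.ClosedSimplex s // a.point ∈ openStar K v} × unitInterval =>
      segmentPoint (sameFace_vertex hv a.1.2) a.2 := by
  refine continuous_segmentPoint hs
    (a := fun a : {a : K.ClosedSimplex s // a.point ∈ openStar K v} × unitInterval => a.1.1.point)
    (b := fun _ => K.vertex v hv) (t := Prod.snd) (fun a => sameFace_vertex hv a.1.2) ?_ ?_ ?_ ?_
    continuous_snd
  · exact fun a => a.1.1.support_subset
  · exact fun a => Finsupp.support_single_subset.trans
      (Finset.singleton_subset_iff.2 (a.1.1.support_subset (mem_openStar_iff.1 a.1.2)))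
  · exact fun w => (continuous_closedSimplex_coord w).comp
      (continuous_subtype_val.comp continuous_fst)
  · exact fun _ => continuous_const

theorem continuous_segmentPoint_vertex (hv : {v} ∈ K) :
    Continuous fun a : openStar K v × unitInterval =>
      segmentPoint (sameFace_vertex hv a.1.2) a.2 := by
  let toVertex (x : openStar K v) : C(unitInterval, K.Realization) :=
    (segmentPath (sameFace_vertex hv x.2)).toContinuousMap
  have htoVertex : Continuous toVertex := by
    refine continuous_of_isOpen_realization isOpen_openStar fun s hs => ?_
    exact (ContinuousMap.curry ⟨_, continuous_segmentPoint_vertex_of_mem hv hs⟩).continuous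
  exact ContinuousMap.continuous_uncurry_of_continuous ⟨toVertex, htoVertex⟩

theorem isSimplyConnected_openStar (hv : {v} ∈ K) : IsSimplyConnected (openStar K v) := by
  have : ContractibleSpace (openStar K v) := by
    rw [contractible_iff_id_nullhomotopic]
    refine ⟨⟨_, vertex_mem_openStar hv⟩, ⟨⟨⟨fun a => ⟨segmentPoint (sameFace_vertex hv a.2.2) a.1,
      segmentPoint_mem_openStar a.2.2 (vertex_mem_openStar hv) _ _⟩, ?_⟩, ?_, ?_⟩⟩⟩
    · exact ((continuous_segmentPoint_vertex hv).comp continuous_swap).subtype_mk _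
    · exact fun a => Subtype.ext (segmentPoint_zero (sameFace_vertex hv a.2))
    · exact fun a => Subtype.ext (segmentPoint_one (sameFace_vertex hv a.2))
  exact SimplyConnectedSpace.ofContractible _

end OpenStar

end Realization

section Rips

open Metric PreAbstractSimplicialComplex

variable {X : Type*} [MetricSpace X] {R r : ℝ} {v x y z : X}

section Ball

variable (hX : SimplyConnectedUpToScale X R) (hR : 2 * r < R)
include hX hR

theorem exists_path_range_subset_ball (hx : x ∈ ball v r) (hy : y ∈ ball v r) :
    ∃ p : Path x y, range p ⊆ ball v r := by
  have hr : 0 < r := pos_of_mem_ball hx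
  obtain ⟨p, hp⟩ := (hX v r hr (by linarith)).isPathConnected.joinedIn x hx y hy
  exact ⟨p, range_subset_iff.2 hp⟩

theorem pathClass_eq_of_range_subset_ball {w : X} {p q : Path x y} (hp : range p ⊆ ball v r)
    (hq : range q ⊆ ball w r) : pathClass p = pathClass q := by
  have hxv : x ∈ ball v r := hp ⟨0, p.source⟩
  have hxw : x ∈ ball w r := hq ⟨0, q.source⟩
  have subset_double {c : X} (hc : x ∈ ball c r) : ball c r ⊆ ball x (2 * r) :=
    ball_subset_ball' (by linarith [mem_ball'.1 hc])
  exact pathClass_eq_of_isSimplyConnected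
    (hX x (2 * r) (by linarith [pos_of_mem_ball hxv]) hR)
    (hp.trans (subset_double hxv)) (hq.trans (subset_double hxw))

/-- The class of the paths joining two points inside an `r`-ball; it does not depend on the
ball. -/
noncomputable def ballClass (h : ∃ v, x ∈ ball v r ∧ y ∈ ball v r) :
    FundamentalGroupoid.mk x ⟶ FundamentalGroupoid.mk y :=
  pathClass (exists_path_range_subset_ball hX hR h.choose_spec.1 h.choose_spec.2).choose

theorem pathClass_eq_ballClass {p : Path x y} (hp : range p ⊆ ball v r)
    (h : ∃ v, x ∈ ball v r ∧ y ∈ ball v r) : pathClass p = ballClass hX hR h :=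
  pathClass_eq_of_range_subset_ball hX hR hp
    (exists_path_range_subset_ball hX hR h.choose_spec.1 h.choose_spec.2).choose_spec

theorem ballClass_self (h : ∃ v, x ∈ ball v r ∧ x ∈ ball v r) : ballClass hX hR h = 𝟙 _ :=
  (pathClass_eq_ballClass hX hR (v := h.choose) (p := Path.refl x)
    (by simpa using h.choose_spec.1) h).symm

theorem ballClass_comp (hx : x ∈ ball v r) (hy : y ∈ ball v r) (hz : z ∈ ball v r) :
    ballClass hX hR ⟨v, hx, hy⟩ ≫ ballClass hX hR ⟨v, hy, hz⟩ = ballClass hX hR ⟨v, hx, hz⟩ := by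
  obtain ⟨p, hp⟩ := exists_path_range_subset_ball hX hR hx hy
  obtain ⟨q, hq⟩ := exists_path_range_subset_ball hX hR hy hz
  have hpq : range (p.trans q) ⊆ ball v r := by
    rw [Path.trans_range]
    exact union_subset hp hq
  rw [← pathClass_eq_ballClass hX hR hp, ← pathClass_eq_ballClass hX hR hq,
    ← pathClass_eq_ballClass hX hR hpq, pathClass_trans]

end Ball

theorem mem_ripsComplex_iff {s : Finset X} :
    s ∈ ripsComplex X r ↔ s.Nonempty ∧ ∀ x ∈ s, ∀ y ∈ s, dist x y < r := by
  refine and_congr_right fun hs => ⟨fun h x hx y hy => ?_, fun h => ?_⟩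
  · exact (dist_le_diam_of_mem s.finite_toSet.isBounded hx hy).trans_lt h
  · obtain ⟨⟨a, b⟩, hab, hmax⟩ := (s ×ˢ s).exists_max_image (fun a => dist a.1 a.2) (hs.product hs)
    obtain ⟨ha, hb⟩ := Finset.mem_product.1 hab
    exact (diam_le_of_forall_dist_le dist_nonneg fun x hx y hy =>
      hmax (x, y) (Finset.mk_mem_product hx hy)).trans_lt (h a ha b hb)

theorem singleton_mem_ripsComplex (hr : 0 < r) (x : X) : {x} ∈ ripsComplex X r :=
  mem_ripsComplex_iff.2 (by simpa using hr)

open Classical in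
theorem triple_mem_ripsComplex (hxy : dist x y < r) (hyz : dist y z < r) (hxz : dist x z < r) :
    {x, y, z} ∈ ripsComplex X r := by
  have hr : 0 < r := dist_nonneg.trans_lt hxy
  refine mem_ripsComplex_iff.2 ⟨Finset.insert_nonempty _ _, ?_⟩
  simp [hr, hxy, hyz, hxz, dist_comm y x, dist_comm z y, dist_comm z x]

open Classical in
theorem pair_mem_ripsComplex (h : dist x y < r) : {x, y} ∈ ripsComplex X r := by
  have hr : 0 < r := dist_nonneg.trans_lt h
  simpa using triple_mem_ripsComplex (x := x) (by simpa using hr) h h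

theorem support_ripsVertex (hr : 0 < r) (x : X) : (ripsVertex hr x).coord.support = {x} :=
  Finsupp.support_single x one_ne_zero

theorem support_ripsVertex_subset_iff (hr : 0 < r) {s : Finset X} :
    (ripsVertex hr x).coord.support ⊆ s ↔ x ∈ s := by
  rw [support_ripsVertex, Finset.singleton_subset_iff]

theorem sameFace_ripsVertex (hr : 0 < r) (h : dist x y < r) :
    SameFace (ripsVertex hr x) (ripsVertex hr y) := by
  classical
  exact ⟨{x, y}, pair_mem_ripsComplex h, (support_ripsVertex_subset_iff hr).2 (by simp),
    (support_ripsVertex_subset_iff hr).2 (by simp)⟩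

theorem segmentClass_ripsVertex_comp (hr : 0 < r) (hxy : dist x y < r) (hyz : dist y z < r)
    (hxz : dist x z < r) :
    segmentClass (sameFace_ripsVertex hr hxy) ≫ segmentClass (sameFace_ripsVertex hr hyz) =
      segmentClass (sameFace_ripsVertex hr hxz) := by
  classical
  exact segmentClass_comp (triple_mem_ripsComplex hxy hyz hxz)
    ((support_ripsVertex_subset_iff hr).2 (by simp))
    ((support_ripsVertex_subset_iff hr).2 (by simp))
    ((support_ripsVertex_subset_iff hr).2 (by simp))

theorem dist_lt_of_mem_ball_half (hx : x ∈ ball v (r / 2)) (hy : y ∈ ball v (r / 2)) :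
    dist x y < r := by
  linarith [dist_triangle_right x y v, mem_ball.1 hx, mem_ball.1 hy]

/-- The edges of the Rips complex, as a transport between nearby points of `X`. -/
noncomputable def edgeTransport (hr : 0 < r) :
    LocalTransport (fun v : X => ball v (r / 2))
      (FundamentalGroupoid (ripsComplex X r).Realization) where
  obj x := ⟨ripsVertex hr x⟩
  hom h := segmentClass (sameFace_ripsVertex hr
    (dist_lt_of_mem_ball_half h.choose_spec.1 h.choose_spec.2))
  hom_self _ := segmentClass_self _
  hom_comp hx hy hz := segmentClass_ripsVertex_comp hr (dist_lt_of_mem_ball_half hx hy)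
    (dist_lt_of_mem_ball_half hy hz) (dist_lt_of_mem_ball_half hx hz)

/-- The functor replacing a path of `X` by a chain of edges of the Rips complex. -/
noncomputable def toRips (hr : 0 < r) :
    FundamentalGroupoid X ⥤ FundamentalGroupoid (ripsComplex X r).Realization :=
  (edgeTransport hr).glue (fun _ => isOpen_ball) fun x => ⟨x, mem_ball_self (half_pos hr)⟩

theorem toRips_pathClass (hr : 0 < r) {p : Path x y} (hp : range p ⊆ ball v (r / 2))
    (h : dist x y < r) :
    (toRips hr).map (pathClass p) = segmentClass (sameFace_ripsVertex hr h) :=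
  (edgeTransport hr).glue_map_pathClass _ _ hp (hp ⟨0, p.source⟩) (hp ⟨1, p.target⟩)

theorem toRips_pathClass_comp (hr : 0 < r) {p : Path x y} (hp : range p ⊆ ball v r)
    (hx : dist x v < r) (hy : dist y v < r) :
    (toRips hr).map (pathClass p) ≫ segmentClass (sameFace_ripsVertex hr hy) =
      segmentClass (sameFace_ripsVertex hr hx) := by
  refine (naturality_of_local (U := fun c : X => ball c (r / 2)) (fun _ => isOpen_ball)
    (fun x _ => mem_iUnion.2 ⟨x, mem_ball_self (half_pos hr)⟩) (F := toRips hr)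
    (G := (Functor.const _).obj ⟨ripsVertex hr v⟩)
    (fun y (hy : y ∈ ball v r) => segmentClass (sameFace_ripsVertex hr (mem_ball.1 hy)))
    (fun c x y p hp hx hy => ?_) p hp hx hy).trans (Category.comp_id _)
  have hxy := dist_lt_of_mem_ball_half (hp ⟨0, p.source⟩) (hp ⟨1, p.target⟩)
  exact (congrArg (· ≫ _) (toRips_pathClass hr hp hxy)).trans
    ((segmentClass_ripsVertex_comp hr hxy hy hx).trans (Category.comp_id _).symm)

theorem carrierVertex_mem_ball {a : (ripsComplex X r).Realization}
    (ha : a ∈ openStar (ripsComplex X r) v) : carrierVertex a ∈ ball v r :=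
  (mem_ripsComplex_iff.1 a.support_mem).2 _ (carrierVertex_mem_support a) _ (mem_openStar_iff.1 ha)

theorem carrierVertex_ripsVertex (hr : 0 < r) (x : X) : carrierVertex (ripsVertex hr x) = x := by
  simpa only [support_ripsVertex, Finset.mem_singleton] using
    carrierVertex_mem_support (ripsVertex hr x)

theorem carrierVertex_ripsVertex_mem_ball (hr : 0 < r) (hx : x ∈ ball v r) :
    carrierVertex (ripsVertex hr x) ∈ ball v r := by
  rwa [carrierVertex_ripsVertex]

section CarrierTransport

variable (hX : SimplyConnectedUpToScale X R) (hR : 2 * r < R)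

theorem exists_ball_carrierVertex {a b : (ripsComplex X r).Realization}
    (h : ∃ v, a ∈ openStar (ripsComplex X r) v ∧ b ∈ openStar (ripsComplex X r) v) :
    ∃ v, carrierVertex a ∈ ball v r ∧ carrierVertex b ∈ ball v r :=
  h.imp fun _ => And.imp carrierVertex_mem_ball carrierVertex_mem_ball

/-- Short paths of `X` between carrier vertices, as a transport between nearby points of the Rips
complex. -/
noncomputable def carrierTransport :
    LocalTransport (openStar (ripsComplex X r)) (FundamentalGroupoid X) where
  obj a := ⟨carrierVertex a⟩
  hom h := ballClass hX hR (exists_ball_carrierVertex h)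
  hom_self _ := ballClass_self hX hR _
  hom_comp ha hb hc := ballClass_comp hX hR (carrierVertex_mem_ball ha)
    (carrierVertex_mem_ball hb) (carrierVertex_mem_ball hc)

/-- The functor replacing each edge of the Rips complex by a short path of `X`. -/
noncomputable def ofRips :
    FundamentalGroupoid (ripsComplex X r).Realization ⥤ FundamentalGroupoid X :=
  (carrierTransport hX hR).glue (fun _ => isOpen_openStar) fun a =>
    ⟨_, mem_openStar_carrierVertex a⟩

theorem ofRips_pathClass {a b : (ripsComplex X r).Realization} {p : Path a b}
    (hp : range p ⊆ openStar (ripsComplex X r) v)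
    (h : ∃ v, carrierVertex a ∈ ball v r ∧ carrierVertex b ∈ ball v r) :
    (ofRips hX hR).map (pathClass p) = ballClass hX hR h :=
  (carrierTransport hX hR).glue_map_pathClass _ _ hp (hp ⟨0, p.source⟩) (hp ⟨1, p.target⟩)

theorem ofRips_segmentClass (hr : 0 < r) (h : dist x y < r) (hx : x ∈ ball v r)
    (hy : y ∈ ball v r) :
    (ofRips hX hR).map (segmentClass (sameFace_ripsVertex hr h)) =
      ballClass hX hR ⟨v, carrierVertex_ripsVertex_mem_ball hr hx,
        carrierVertex_ripsVertex_mem_ball hr hy⟩ := by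
  classical
  have hs := pair_mem_ripsComplex h
  have hxs : (ripsVertex hr x).coord.support ⊆ {x, y} :=
    (support_ripsVertex_subset_iff hr).2 (by simp)
  have hys : (ripsVertex hr y).coord.support ⊆ {x, y} :=
    (support_ripsVertex_subset_iff hr).2 (by simp)
  have hxx : ripsVertex hr x ∈ openStar _ x := vertex_mem_openStar _
  have hyy : ripsVertex hr y ∈ openStar _ y := vertex_mem_openStar _
  -- An interior point of the edge lies in the open stars of both ends, so it splits the edge
  -- into two segments on each of which `ofRips` is given by a short path.
  obtain ⟨t, ht⟩ := exists_between (zero_lt_one (α := unitInterval))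
  set m := segmentPoint (sameFace_ripsVertex hr h) t
  have hms : m.coord.support ⊆ {x, y} := support_segmentPoint_subset _ hxs hys _
  have hmx : m ∈ openStar _ x := segmentPoint_mem_openStar_of_mem_Ioo _ ht (.inl hxx)
  have hmy : m ∈ openStar _ y := segmentPoint_mem_openStar_of_mem_Ioo _ ht (.inr hyy)
  have hmv : carrierVertex m ∈ ball v r := by
    rcases Finset.mem_insert.1 (hms (carrierVertex_mem_support m)) with hm | hm
    · rwa [hm]
    · rwa [Finset.mem_singleton.1 hm]
  rw [← segmentClass_comp hs hxs hms hys, Functor.map_comp,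
    ← ballClass_comp hX hR (carrierVertex_ripsVertex_mem_ball hr hx) hmv
      (carrierVertex_ripsVertex_mem_ball hr hy)]
  exact congrArg₂ (· ≫ ·) (ofRips_pathClass hX hR (range_segmentPath_subset_openStar hxx hmx _) _)
    (ofRips_pathClass hX hR (range_segmentPath_subset_openStar hmy hyy _) _)

/-- The class of a path of `X` survives its replacement by a chain of edges and back. -/
noncomputable def toRipsCompOfRipsIso (hr : 0 < r) :
    toRips hr ⋙ ofRips hX hR ≅ 𝟭 (FundamentalGroupoid X) :=
  natIsoOfLocal (U := fun c : X => ball c (r / 2)) (fun _ => isOpen_ball)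
    (fun x => ⟨x, mem_ball_self (half_pos hr)⟩)
    (fun x => ballClass hX hR ⟨x, carrierVertex_ripsVertex_mem_ball hr (mem_ball_self hr),
      mem_ball_self hr⟩)
    fun c x y p hp => by
      have hp' : range p ⊆ ball c r := hp.trans (ball_subset_ball (by linarith))
      have hx : x ∈ ball c r := hp' ⟨0, p.source⟩
      have hy : y ∈ ball c r := hp' ⟨1, p.target⟩
      have hkx := carrierVertex_ripsVertex_mem_ball hr hx
      have hky := carrierVertex_ripsVertex_mem_ball hr hy
      have hxy := dist_lt_of_mem_ball_half (hp ⟨0, p.source⟩) (hp ⟨1, p.target⟩)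
      have hround : (toRips hr ⋙ ofRips hX hR).map (pathClass p) = ballClass hX hR ⟨c, hkx, hky⟩ :=
        (congrArg (ofRips hX hR).map (toRips_pathClass hr hp hxy)).trans
          (ofRips_segmentClass hX hR hr hxy hx hy)
      calc _ = ballClass hX hR ⟨c, hkx, hky⟩ ≫ ballClass hX hR ⟨c, hky, hy⟩ :=
            congrArg (· ≫ _) hround
        _ = ballClass hX hR ⟨c, hkx, hx⟩ ≫ ballClass hX hR ⟨c, hx, hy⟩ := by
            rw [ballClass_comp hX hR hkx hky hy, ballClass_comp hX hR hkx hx hy]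
        _ = ballClass hX hR ⟨c, hkx, hx⟩ ≫ pathClass p := by
            rw [pathClass_eq_ballClass hX hR hp']

theorem toRips_ofRips_pathClass_comp (hr : 0 < r) {a b : (ripsComplex X r).Realization}
    {p : Path a b} (hp : range p ⊆ openStar (ripsComplex X r) v)
    (ha : dist (carrierVertex a) v < r) (hb : dist (carrierVertex b) v < r) :
    (toRips hr).map ((ofRips hX hR).map (pathClass p)) ≫
        segmentClass (sameFace_ripsVertex hr hb) =
      segmentClass (sameFace_ripsVertex hr ha) := by
  obtain ⟨q, hq⟩ := exists_path_range_subset_ball hX hR (mem_ball.2 ha) (mem_ball.2 hb)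
  have hpq : (ofRips hX hR).map (pathClass p) = pathClass q :=
    (ofRips_pathClass hX hR hp ⟨v, ha, hb⟩).trans (pathClass_eq_ballClass hX hR hq _).symm
  exact (congrArg (fun f => (toRips hr).map f ≫ _) hpq).trans (toRips_pathClass_comp hr hq ha hb)

end CarrierTransport

theorem sameFace_ripsVertex_of_mem_openStar (hr : 0 < r) {a : (ripsComplex X r).Realization}
    (ha : a ∈ openStar (ripsComplex X r) v) : SameFace a (ripsVertex hr v) :=
  sameFace_vertex (singleton_mem_ripsComplex hr v) ha

theorem segmentClass_carrierVertex_comp (hr : 0 < r) {a : (ripsComplex X r).Realization}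
    (ha : a ∈ openStar (ripsComplex X r) v) (hv : dist (carrierVertex a) v < r) :
    segmentClass (sameFace_ripsVertex_of_mem_openStar hr (mem_openStar_carrierVertex a)) ≫
        segmentClass (sameFace_ripsVertex hr hv) =
      segmentClass (sameFace_ripsVertex_of_mem_openStar hr ha) :=
  segmentClass_comp a.support_mem subset_rfl
    ((support_ripsVertex_subset_iff hr).2 (carrierVertex_mem_support a))
    ((support_ripsVertex_subset_iff hr).2 (mem_openStar_iff.1 ha))

theorem pathClass_comp_segmentClass_of_openStar (hr : 0 < r)
    {a b : (ripsComplex X r).Realization} {p : Path a b}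
    (hp : range p ⊆ openStar (ripsComplex X r) v) (ha : a ∈ openStar (ripsComplex X r) v)
    (hb : b ∈ openStar (ripsComplex X r) v) :
    pathClass p ≫ segmentClass (sameFace_ripsVertex_of_mem_openStar hr hb) =
      segmentClass (sameFace_ripsVertex_of_mem_openStar hr ha) := by
  have hv := singleton_mem_ripsComplex hr v
  have segment_subset {c} (hc : c ∈ openStar (ripsComplex X r) v) :=
    range_segmentPath_subset_openStar hc (vertex_mem_openStar hv) (sameFace_vertex hv hc)
  refine pathClass_eq_of_isSimplyConnected (isSimplyConnected_openStar hv)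
    (p := p.trans (segmentPath _)) ?_ (segment_subset ha)
  rw [Path.trans_range]
  exact union_subset hp (segment_subset hb)

/-- The class of a path of the Rips complex survives its replacement by a path of `X` and back. -/
noncomputable def ofRipsCompToRipsIso (hX : SimplyConnectedUpToScale X R) (hR : 2 * r < R)
    (hr : 0 < r) :
    𝟭 (FundamentalGroupoid (ripsComplex X r).Realization) ≅ ofRips hX hR ⋙ toRips hr :=
  natIsoOfLocal (U := openStar (ripsComplex X r)) (fun _ => isOpen_openStar)
    (fun a => ⟨_, mem_openStar_carrierVertex a⟩)
    (fun a => segmentClass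
      (sameFace_ripsVertex_of_mem_openStar hr (mem_openStar_carrierVertex a)))
    fun v a b p hp => by
      have ha := hp ⟨0, p.source⟩
      have hb := hp ⟨1, p.target⟩
      have hav : dist (carrierVertex a) v < r := carrierVertex_mem_ball ha
      have hbv : dist (carrierVertex b) v < r := carrierVertex_mem_ball hb
      let edge := segmentClass (sameFace_ripsVertex hr hbv)
      let toCarrier (c : (ripsComplex X r).Realization) :=
        segmentClass (sameFace_ripsVertex_of_mem_openStar hr (mem_openStar_carrierVertex c))
      refine (cancel_mono edge).1 ?_
      calc (pathClass p ≫ toCarrier b) ≫ edge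
          = pathClass p ≫ segmentClass (sameFace_ripsVertex_of_mem_openStar hr hb) := by
            rw [Category.assoc, segmentClass_carrierVertex_comp hr hb hbv]
        _ = segmentClass (sameFace_ripsVertex_of_mem_openStar hr ha) :=
            pathClass_comp_segmentClass_of_openStar hr hp ha hb
        _ = toCarrier a ≫ segmentClass (sameFace_ripsVertex hr hav) :=
            (segmentClass_carrierVertex_comp hr ha hav).symm
        _ = toCarrier a ≫ (toRips hr).map ((ofRips hX hR).map (pathClass p)) ≫ edge :=
            congrArg (_ ≫ ·) (toRips_ofRips_pathClass_comp hX hR hr hp hav hbv).symm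
        _ = (toCarrier a ≫ (toRips hr).map ((ofRips hX hR).map (pathClass p))) ≫ edge :=
            (Category.assoc _ _ _).symm

/-- The fundamental groupoid of the Rips complex is that of the space. -/
noncomputable def ripsEquivalence (hX : SimplyConnectedUpToScale X R) (hR : 2 * r < R)
    (hr : 0 < r) :
    FundamentalGroupoid X ≌ FundamentalGroupoid (ripsComplex X r).Realization :=
  .mk (toRips hr) (ofRips hX hR) (toRipsCompOfRipsIso hX hR hr).symm
    (ofRipsCompToRipsIso hX hR hr).symm

/-- The inclusion of Rips complexes takes edges to edges. -/
noncomputable def toRipsCompRipsInclusionIso {r' : ℝ} (hr : 0 < r) (h : r ≤ r') :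
    toRips hr ⋙ FundamentalGroupoid.map (ripsInclusion X h) ≅ toRips (hr.trans_le h) :=
  natIsoOfLocal (U := fun c : X => ball c (r / 2)) (fun _ => isOpen_ball)
    (fun x => ⟨x, mem_ball_self (half_pos hr)⟩)
    (fun x => 𝟙 (FundamentalGroupoid.mk (ripsVertex (hr.trans_le h) x)))
    fun c x y p hp => by
      have hxy := dist_lt_of_mem_ball_half (hp ⟨0, p.source⟩) (hp ⟨1, p.target⟩)
      have hp' : range p ⊆ ball c (r' / 2) := hp.trans (ball_subset_ball (by linarith))
      have hedge : (FundamentalGroupoid.map (ripsInclusion X h)).map ((toRips hr).map (pathClass p))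
          = (toRips (hr.trans_le h)).map (pathClass p) :=
        (congrArg (FundamentalGroupoid.map _).map (toRips_pathClass hr hp hxy)).trans
          ((map_inclusion_segmentClass _ _).trans
            (toRips_pathClass (hr.trans_le h) hp' (hxy.trans_le h)).symm)
      exact (Category.comp_id _).trans (hedge.trans (Category.id_comp _).symm)

theorem isEquivalence_map_ripsInclusion {r' : ℝ} (hX : SimplyConnectedUpToScale X R)
    (hR : 2 * r' < R) (hr : 0 < r) (h : r ≤ r') :
    (FundamentalGroupoid.map (ripsInclusion X h)).IsEquivalence := by
  have : (toRips (X := X) hr).IsEquivalence :=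
    (ripsEquivalence hX (by linarith) hr).isEquivalence_functor
  have : (toRips (X := X) (hr.trans_le h)).IsEquivalence :=
    (ripsEquivalence hX hR (hr.trans_le h)).isEquivalence_functor
  have := Functor.isEquivalence_of_iso (toRipsCompRipsInclusionIso (X := X) hr h).symm
  exact Functor.isEquivalence_of_comp_left (toRips hr) _

end Rips

theorem mapOfEq_bijective_of_fullyFaithful {Y Z : Type*} [TopologicalSpace Y] [TopologicalSpace Z]
    (f : C(Y, Z)) [(FundamentalGroupoid.map f).Full] [(FundamentalGroupoid.map f).Faithful]
    {y : Y} {z : Z} (h : f y = z) : Function.Bijective (FundamentalGroup.mapOfEq f h) :=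
  ((eqToIso (congrArg FundamentalGroupoid.mk h)).conj.bijective).comp
    ((Functor.FullyFaithful.ofFullyFaithful (FundamentalGroupoid.map f)).map_bijective _ _)

theorem theorem4p9_general {X : Type*} [MetricSpace X] (x₀ : X) {R : ℝ}
    (hX : SimplyConnectedUpToScale X R) :
    (∀ (r : ℝ) (hr : 0 < r), 2 * r < R →
      Nonempty (FundamentalGroup (ripsComplex X r).Realization (ripsVertex hr x₀) ≃*
        FundamentalGroup X x₀)) ∧
    (∀ (r r' : ℝ) (hr : 0 < r) (hrr' : r ≤ r'), 2 * r' < R →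
      Function.Bijective (FundamentalGroup.mapOfEq (ripsInclusion X hrr')
        (ripsInclusion_vertex hr hrr' x₀))) := by
  refine ⟨fun r hr hR => ?_, fun r r' hr hrr' hR => ?_⟩
  · exact ⟨((ripsEquivalence hX hR hr).fullyFaithfulFunctor.mulEquivEnd ⟨x₀⟩).symm⟩
  · have := isEquivalence_map_ripsInclusion hX hR hr hrr'
    exact mapOfEq_bijective_of_fullyFaithful _ _

theorem theorem4p9 {X : Type*} [MetricSpace X] [CompactSpace X] (x₀ : X) (R : ℝ) (hR : 0 < R)
    (hX : SimplyConnectedUpToScale X R) :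
    (∀ (r : ℝ) (hr : 0 < r), r < R / 3 →
      Nonempty (FundamentalGroup (ripsComplex X r).Realization (ripsVertex hr x₀) ≃*
        FundamentalGroup X x₀)) ∧
    (∀ (r r' : ℝ) (hr : 0 < r) (hrr' : r < r'), r' < R / 3 →
      Function.Bijective (FundamentalGroup.mapOfEq (ripsInclusion X hrr'.le)
        (ripsInclusion_vertex hr hrr'.le x₀))) := by
  have h := theorem4p9_general x₀ hX
  exact ⟨fun r hr hrR => h.1 r hr (by linarith),
    fun r r' hr hrr' hrR => h.2 r r' hr hrr'.le (by linarith)⟩
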